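/- Let $p$ be a prime, let $n>1$, and let $K=\mathbb{Z}/p\mathbb{Z}$. Equip the configuration space $(K^n)^{\mathbb{Z}}$ with the distance $d(c,c')=2^{-\min\{|j|\,:\,c_j\neq c'_j\}}$ for $c\neq c'$, and $d(c,c)=0$. Let $\mathcal{F}:(K^n)^{\mathbb{Z}}\to(K^n)^{\mathbb{Z}}$ be a linear cellular automaton, i.e. for some $r\in\mathbb{N}$ and matrices $A_{-r},\dots,A_r\in K^{n\times n}$ we have $\mathcal{F}(c)_i=\sum_{j=-r}^{r}A_j\,c_{i+j}$ for all configurations $c$ and all $i\in\mathbb{Z}$, and let $A=\sum_{j=-r}^{r}A_jX^{-j}\in K[X,X^{-1}]^{n\times n}$ be the matrix associated with $\mathcal{F}$. For a nonzero Laurent polynomial $\alpha\in K[X,X^{-1}]$ let $\deg^+(\alpha)$ and $\deg^-(\alpha)$ be the maximum and the minimum of the degrees of its monomials, and put $\deg^+(0)=-\infty$, $\deg^-(0)=+\infty$. Write $\det(tI_n-A)=\alpha_0+\alpha_1t+\cdots+\alpha_{n-1}t^{n-1}+t^n$. The matrix $A$ is called expansive if $\alpha_0\neq 0$ and (i) $\deg^+(\alpha_0)>0$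 and $\deg^+(\alpha_0)>\deg^+(\alpha_i)$ for every $i\in\{1,\dots,n-1\}$; (ii) $\deg^-(\alpha_0)<0$ and $\deg^-(\alpha_0)<\deg^-(\alpha_i)$ for every $i\in\{1,\dots,n-1\}$. Then $\mathcal{F}$ is positively expansive, i.e. there is $\varepsilon>0$ such that for all configurations $c\neq c'$ there is a natural number $\ell\geq 0$ with $d(\mathcal{F}^{\ell}(c),\mathcal{F}^{\ell}(c'))\geq\varepsilon$, if and only if $A$ is expansive. -/

import Mathlib

open scoped LaurentPolynomial

/-- Configurations over the alphabet `S`. -/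
abbrev Config (S : Type*) : Type _ := ℤ → S

open Classical in
/-- The standard Tychonoff distance: `0` if `c = c'`, and otherwise `2 ^ (-k)` with `k` the least
`|j|` such that `c j ≠ c' j`. -/
noncomputable def configDist {S : Type*} (c c' : Config S) : ℝ :=
  if c = c' then 0 else (2 : ℝ)⁻¹ ^ sInf {k : ℕ | ∃ j : ℤ, j.natAbs = k ∧ c j ≠ c' j}

/-- Positive expansivity of a self-map of the configuration space. -/
def PositivelyExpansive {S : Type*} (F : Config S → Config S) : Prop :=
  ∃ ε : ℝ, 0 < ε ∧ ∀ c c' : Config S, c ≠ c' → ∃ l : ℕ, ε ≤ configDist (F^[l] c) (F^[l] c')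

/-- The window `{-r, …, r}` of radius `r`. -/
abbrev Window (r : ℕ) : Type := Finset.Icc (-(r : ℤ)) (r : ℤ)

/-- The global rule of the one-dimensional cellular automaton with local rule `f` of radius `r`:
`F(c)_i = f (c_{i-r}, …, c_{i+r})`. -/
def globalRule {S : Type*} (r : ℕ) (f : (Window r → S) → S) : Config S → Config S :=
  fun c i => f fun j => c (i + (j : ℤ))

/-- The linear local rule `f (x_{-r}, …, x_r) = ∑ A_j x_j` given by matrices `A_{-r}, …, A_r`. -/
noncomputable def linearLocalRule {K : Type*} [CommRing K] {n : ℕ} (r : ℕ)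
    (A : Window r → Matrix (Fin n) (Fin n) K) (x : Window r → Fin n → K) : Fin n → K :=
  ∑ j : Window r, (A j).mulVec (x j)

/-- The Laurent polynomial matrix `∑ A_j X^{-j}` given by matrices `A_{-r}, …, A_r`. -/
noncomputable def laurentMatrix {K : Type*} [CommRing K] {n : ℕ} (r : ℕ)
    (A : Window r → Matrix (Fin n) (Fin n) K) : Matrix (Fin n) (Fin n) K[T;T⁻¹] :=
  ∑ j : Window r, (A j).map fun a => LaurentPolynomial.C a * LaurentPolynomial.T (-(j : ℤ))

/-- `F` is a linear cellular automaton over `K^n` and `M` is the matrix associated with it. -/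
def IsLinearCAWithMatrix {K : Type*} [CommRing K] {n : ℕ}
    (F : Config (Fin n → K) → Config (Fin n → K)) (M : Matrix (Fin n) (Fin n) K[T;T⁻¹]) : Prop :=
  ∃ (r : ℕ) (A : Window r → Matrix (Fin n) (Fin n) K),
    F = globalRule r (linearLocalRule r A) ∧ M = laurentMatrix r A

/-- The positive degree: the greatest degree of a monomial of `α`, and `-∞` for `α = 0`. -/
def posDeg {K : Type*} [CommRing K] (α : K[T;T⁻¹]) : WithBot ℤ := α.degree

/-- The negative degree: the least degree of a monomial of `α`, and `+∞` for `α = 0`. -/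
def negDeg {K : Type*} [CommRing K] (α : K[T;T⁻¹]) : WithTop ℤ := α.coeff.support.min

/-- Expansivity of a (monic) polynomial `α_0 + α_1 t + ⋯ + α_{n-1} t^{n-1} + t^n` with Laurent
polynomial coefficients. -/
def ExpansivePolynomial {K : Type*} [CommRing K] (π : Polynomial K[T;T⁻¹]) : Prop :=
  π.coeff 0 ≠ 0 ∧
  (0 < posDeg (π.coeff 0) ∧
    ∀ i : ℕ, 1 ≤ i → i < π.natDegree → posDeg (π.coeff i) < posDeg (π.coeff 0)) ∧
  (negDeg (π.coeff 0) < 0 ∧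
    ∀ i : ℕ, 1 ≤ i → i < π.natDegree → negDeg (π.coeff 0) < negDeg (π.coeff i))

/-- A matrix of Laurent polynomials is expansive if its characteristic polynomial is. -/
def ExpansiveMatrix {K : Type*} [CommRing K] {n : ℕ}
    (M : Matrix (Fin n) (Fin n) K[T;T⁻¹]) : Prop :=
  ExpansivePolynomial M.charpoly

/-!
Over a field `K`, configurations are the linear functionals on `E = K[T;T⁻¹]^n`: the value
`c (-i) k` is the value at `T ^ i • e_k` (`configFunctional`). Under this pairing a linear cellular
automaton with matrix `M` is dual to multiplication by the transpose `N = Mᵀ`. Positive expansivity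
says that, for some `d`, a configuration whose orbit vanishes on `[-d, d]` is zero; a proper
subspace is killed by a nonzero functional, so this means that the vectors `N ^ l (T ^ i • e_k)`
with `|i| ≤ d` span `E` (`positivelyExpansive_iff_windowSpan`). In other words, `E` is finitely
generated over `K[t]`, with `t` acting as `N`.

If it is, then multiplication by `T` and by `T⁻¹` on `E` satisfies monic equations over `K[t]`.
A polynomial in `K[T;T⁻¹][t]` that vanishes at `N` is, after raising to the power `n`, a multiple
of the characteristic polynomial `χ` (`charpoly_dvd_pow_of_aeval_eq_zero`). Viewing `χ` as a
Laurent polynomial in `T` over the domain `K[t]`, its highest and lowest coefficients thus divide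
`1`, so they are nonzero constants. This says exactly that `χ` is expansive: the extreme powers of
`T` occur in the coefficient of `t ^ 0` only (`hasConstantTop_iff`, `hasConstantBottom_iff`).

Conversely, if both extreme coefficients are nonzero constants, the Cayley–Hamilton relation
`χ(N) = 0` can be solved for the term with the highest or the lowest power of `T`, and induction on
`|m|` puts every `T ^ m • e_k` in the span of a window (`exists_windowSpan_eq_top`).
-/

/-! ### Duality between configurations and vectors of Laurent polynomials -/

/-- The `K`-span of the vectors `N ^ l * (T ^ i • e_k)` with `|i| ≤ d`, that is, the
`K[t]`-submodule generated by the monomial vectors of degree in `[-d, d]` when `t` acts as `N`. -/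
noncomputable def windowSpan {K : Type*} [Field K] {n : ℕ}
    (N : Matrix (Fin n) (Fin n) K[T;T⁻¹]) (d : ℕ) : Submodule K (Fin n → K[T;T⁻¹]) :=
  Submodule.span K {v | ∃ (l : ℕ) (i : ℤ) (k : Fin n), i.natAbs ≤ d ∧
    v = (N ^ l).mulVec (Pi.single k (LaurentPolynomial.T i))}

/-- The configuration `c` as a linear functional on `K[T;T⁻¹]^n`, sending `T ^ i • e_k` to
`c (-i) k`. The sign makes a linear cellular automaton dual to the transpose of its matrix. -/
noncomputable def configFunctional {K : Type*} [Field K] {n : ℕ} (c : Config (Fin n → K)) :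
    (Fin n → K[T;T⁻¹]) →ₗ[K] K :=
  ∑ k : Fin n, (Finsupp.linearCombination K fun i : ℤ => c (-i) k) ∘ₗ
    (AddMonoidAlgebra.coeffLinearEquiv K).toLinearMap ∘ₗ LinearMap.proj k

section Duality

variable {K : Type*} [Field K] {n : ℕ}

lemma configFunctional_apply (c : Config (Fin n → K)) (v : Fin n → K[T;T⁻¹]) :
    configFunctional c v =
      ∑ k, Finsupp.linearCombination K (fun i : ℤ => c (-i) k) (v k).coeff := by
  simp [configFunctional]

lemma configFunctional_single (c : Config (Fin n → K)) (k : Fin n) (i : ℤ) :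
    configFunctional c (Pi.single k (LaurentPolynomial.T i)) = c (-i) k := by
  rw [configFunctional_apply, Finset.sum_eq_single k]
  · rw [Pi.single_eq_same, LaurentPolynomial.T, AddMonoidAlgebra.coeff_single,
      Finsupp.linearCombination_single, one_smul]
  · intro l _ hl
    simp [Pi.single_eq_of_ne hl]
  · simp

lemma linearMap_ext_single {V : Type*} [AddCommGroup V] [Module K V]
    {f g : (Fin n → K[T;T⁻¹]) →ₗ[K] V}
    (h : ∀ k i, f (Pi.single k (LaurentPolynomial.T i)) =
      g (Pi.single k (LaurentPolynomial.T i))) : f = g := by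
  refine LinearMap.pi_ext fun k p => ?_
  induction p using LaurentPolynomial.induction_on' with
  | add p q hp hq => rw [Pi.single_add, map_add, map_add, hp, hq]
  | C_mul_T i a =>
    rw [← LaurentPolynomial.smul_eq_C_mul, Pi.single_smul, map_smul, map_smul, h]

lemma exists_configFunctional_eq (φ : (Fin n → K[T;T⁻¹]) →ₗ[K] K) :
    ∃ c, configFunctional c = φ :=
  ⟨fun i k => φ (Pi.single k (LaurentPolynomial.T (-i))), linearMap_ext_single fun k i => by
    rw [configFunctional_single, neg_neg]⟩

lemma configFunctional_globalRule (r : ℕ) (A : Window r → Matrix (Fin n) (Fin n) K)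
    (c : Config (Fin n → K)) (v : Fin n → K[T;T⁻¹]) :
    configFunctional (globalRule r (linearLocalRule r A) c) v =
      configFunctional c ((laurentMatrix r A).transpose.mulVec v) := by
  suffices h : configFunctional (globalRule r (linearLocalRule r A) c) = configFunctional c ∘ₗ
      (laurentMatrix r A).transpose.mulVecLin.restrictScalars K by
    rw [h]; rfl
  refine linearMap_ext_single fun k i => ?_
  have hcol : ∀ l, ((laurentMatrix r A).transpose.mulVec
      (Pi.single k (LaurentPolynomial.T i))) l =
      ∑ j : Window r, A j k l • LaurentPolynomial.T (i - j) := by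
    intro l
    rw [Matrix.mulVec_single]
    simp only [laurentMatrix, Pi.smul_apply, Matrix.col_apply, Matrix.transpose_apply,
      Matrix.sum_apply, Matrix.map_apply, op_smul_eq_mul, Finset.sum_mul]
    refine Finset.sum_congr rfl fun j _ => ?_
    rw [LaurentPolynomial.smul_eq_C_mul, mul_assoc, ← LaurentPolynomial.T_add, neg_add_eq_sub]
  rw [configFunctional_single]
  simp only [LinearMap.comp_apply, LinearMap.restrictScalars_apply, Matrix.mulVecLin_apply]
  rw [configFunctional_apply]
  simp only [hcol, AddMonoidAlgebra.coeff_sum, AddMonoidAlgebra.coeff_smul, map_sum, map_smul]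
  rw [Finset.sum_comm]
  simp only [globalRule, linearLocalRule, Finset.sum_apply, Matrix.mulVec, dotProduct]
  refine Finset.sum_congr rfl fun j _ => Finset.sum_congr rfl fun l _ => ?_
  rw [LaurentPolynomial.T, AddMonoidAlgebra.coeff_single, Finsupp.linearCombination_single,
    one_smul, smul_eq_mul, neg_sub, sub_eq_neg_add]

lemma configFunctional_iterate (r : ℕ) (A : Window r → Matrix (Fin n) (Fin n) K)
    (c : Config (Fin n → K)) (l : ℕ) (v : Fin n → K[T;T⁻¹]) :
    configFunctional ((globalRule r (linearLocalRule r A))^[l] c) v =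
      configFunctional c (((laurentMatrix r A).transpose ^ l).mulVec v) := by
  induction l generalizing v with
  | zero => simp
  | succ l ih =>
    rw [Function.iterate_succ_apply', configFunctional_globalRule, ih, Matrix.mulVec_mulVec,
      pow_succ]

/-- By duality, the window `[-d, d]` separates the orbits of `0` and of every nonzero
configuration if and only if its monomial vectors generate everything under the transpose. -/
lemma windowSpan_eq_top_iff (r : ℕ) (A : Window r → Matrix (Fin n) (Fin n) K) (d : ℕ) :
    windowSpan (laurentMatrix r A).transpose d = ⊤ ↔
      ∀ c : Config (Fin n → K), (∀ (l : ℕ) (i : ℤ), i.natAbs ≤ d →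
        (globalRule r (linearLocalRule r A))^[l] c i = 0) → c = 0 := by
  constructor
  · intro h c hc
    have hker : windowSpan (laurentMatrix r A).transpose d ≤
        LinearMap.ker (configFunctional c) := by
      refine Submodule.span_le.2 ?_
      rintro _ ⟨l, i, k, hi, rfl⟩
      change configFunctional c _ = 0
      rw [← configFunctional_iterate, configFunctional_single, hc l (-i) (by simpa using hi)]
      rfl
    funext i k
    have := hker (h ▸ Submodule.mem_top : Pi.single k (LaurentPolynomial.T (-i)) ∈ _)
    rw [LinearMap.mem_ker, configFunctional_single, neg_neg] at this
    exact this
  · intro h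
    by_contra hne
    obtain ⟨φ, hφ, hle⟩ := Submodule.exists_le_ker_of_lt_top _ (lt_top_iff_ne_top.2 hne)
    obtain ⟨c, rfl⟩ := exists_configFunctional_eq φ
    refine hφ ?_
    have hc : c = 0 := h c fun l i hi => by
      funext k
      have hmem : ((laurentMatrix r A).transpose ^ l).mulVec
          (Pi.single k (LaurentPolynomial.T (-i))) ∈
            windowSpan (laurentMatrix r A).transpose d :=
        Submodule.subset_span ⟨l, -i, k, by simpa using hi, rfl⟩
      have := hle hmem
      rw [LinearMap.mem_ker, ← configFunctional_iterate, configFunctional_single, neg_neg] at this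
      exact this
    subst hc
    ext v
    simp [configFunctional_apply, Finsupp.linearCombination_apply]

end Duality

/-! ### Positive expansivity in terms of windows -/

section Windows

variable {S : Type*}

lemma configDist_lt_of_agree {c c' : Config S} {d : ℕ}
    (h : ∀ j : ℤ, j.natAbs ≤ d → c j = c' j) : configDist c c' < 2⁻¹ ^ d := by
  unfold configDist
  split_ifs with hcc
  · positivity
  · refine pow_lt_pow_right_of_lt_one₀ (by norm_num) (by norm_num) ?_
    obtain ⟨j, hj⟩ := Function.ne_iff.1 hcc
    obtain ⟨i, hi, hne⟩ :=
      Nat.sInf_mem (s := {k : ℕ | ∃ j : ℤ, j.natAbs = k ∧ c j ≠ c' j}) ⟨_, j, rfl, hj⟩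
    rw [← hi]
    by_contra! hle
    exact hne (h i hle)

lemma le_configDist_of_ne {c c' : Config S} {d : ℕ} {j : ℤ} (hj : j.natAbs ≤ d)
    (h : c j ≠ c' j) : (2 : ℝ)⁻¹ ^ d ≤ configDist c c' := by
  unfold configDist
  rw [if_neg fun hcc => h (congrFun hcc j)]
  have hmem : j.natAbs ∈ {k : ℕ | ∃ j : ℤ, j.natAbs = k ∧ c j ≠ c' j} := ⟨j, rfl, h⟩
  exact pow_le_pow_of_le_one (by norm_num) (by norm_num) ((Nat.sInf_le hmem).trans hj)

lemma positivelyExpansive_iff_window {F : Config S → Config S} :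
    PositivelyExpansive F ↔ ∃ d : ℕ, ∀ c c' : Config S,
      (∀ (l : ℕ) (j : ℤ), j.natAbs ≤ d → F^[l] c j = F^[l] c' j) → c = c' := by
  constructor
  · rintro ⟨ε, hε, h⟩
    obtain ⟨d, hd⟩ := exists_pow_lt_of_lt_one hε (show (2 : ℝ)⁻¹ < 1 by norm_num)
    refine ⟨d, fun c c' hcc => ?_⟩
    by_contra hne
    obtain ⟨l, hl⟩ := h c c' hne
    exact absurd (configDist_lt_of_agree (hcc l)) (not_lt.2 (hd.le.trans hl))
  · rintro ⟨d, h⟩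
    refine ⟨2⁻¹ ^ d, by positivity, fun c c' hne => ?_⟩
    by_contra! hlt
    refine hne (h c c' fun l j hj => ?_)
    by_contra hne'
    exact absurd (hlt l) (not_lt.2 (le_configDist_of_ne hj hne'))

end Windows

lemma globalRule_iterate_sub {K : Type*} [Field K] {n : ℕ} (r : ℕ)
    (A : Window r → Matrix (Fin n) (Fin n) K) (c c' : Config (Fin n → K)) (l : ℕ) :
    (globalRule r (linearLocalRule r A))^[l] (c - c') =
      (globalRule r (linearLocalRule r A))^[l] c -
        (globalRule r (linearLocalRule r A))^[l] c' := by
  induction l generalizing c c' with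
  | zero => rfl
  | succ l ih =>
    rw [Function.iterate_succ_apply, Function.iterate_succ_apply, Function.iterate_succ_apply,
      ← ih]
    congr 1
    funext i
    simp only [globalRule, linearLocalRule, Pi.sub_apply, ← Finset.sum_sub_distrib,
      ← Matrix.mulVec_sub]

/-- A linear cellular automaton is positively expansive if and only if `K[T;T⁻¹]^n` is generated,
as a `K[t]`-module with `t` acting as the transposed matrix, by the vectors of some window. -/
lemma positivelyExpansive_iff_windowSpan {K : Type*} [Field K] {n : ℕ} (r : ℕ)
    (A : Window r → Matrix (Fin n) (Fin n) K) :
    PositivelyExpansive (globalRule r (linearLocalRule r A)) ↔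
      ∃ d, windowSpan (laurentMatrix r A).transpose d = ⊤ := by
  rw [positivelyExpansive_iff_window]
  refine exists_congr fun d => ?_
  rw [windowSpan_eq_top_iff]
  have hzero : ∀ l, (globalRule r (linearLocalRule r A))^[l] 0 = 0 := fun l => by
    simpa using globalRule_iterate_sub r A 0 0 l
  constructor
  · intro h c hc
    exact h c 0 fun l j hj => by rw [hc l j hj, hzero]; rfl
  · intro h c c' hc
    refine sub_eq_zero.1 (h _ fun l j hj => ?_)
    rw [globalRule_iterate_sub, Pi.sub_apply, hc l j hj, sub_self]

/-! ### Integrality and the characteristic polynomial -/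

section Integrality

/-- Cayley–Hamilton for an `A`-module that is finite over `R` through `φ : R → A`. -/
lemma exists_monic_eval₂_smul_eq_zero {R A E : Type*} [CommRing R] [CommRing A]
    [AddCommGroup E] [Module A E] (φ : R →+* A)
    (hfin : @Module.Finite R E _ _ (Module.compHom E φ)) (x : A) :
    ∃ ψ : Polynomial R, ψ.Monic ∧ ∀ e : E, ψ.eval₂ φ x • e = 0 := by
  let : Algebra R A := φ.toAlgebra
  let : Module R E := Module.compHom E φ
  have : IsScalarTower R A E := IsScalarTower.of_algebraMap_smul fun _ _ => rfl
  have : Module.Finite R E := hfin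
  obtain ⟨ψ, hψ, h⟩ := LinearMap.exists_monic_and_aeval_eq_zero R (Algebra.lsmul R R E x)
  refine ⟨ψ, hψ, fun e => ?_⟩
  rw [Polynomial.aeval_algHom_apply] at h
  exact LinearMap.congr_fun h e

/-- Since `t - N` divides `q(t) - q(N)`, a polynomial vanishing at `N` is a multiple of the
characteristic polynomial once raised to the size of `N`. -/
lemma charpoly_dvd_pow_of_aeval_eq_zero {R : Type*} [CommRing R] {n : ℕ}
    (N : Matrix (Fin n) (Fin n) R) (q : Polynomial R) (hq : Polynomial.aeval N q = 0) :
    N.charpoly ∣ q ^ n := by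
  set N' : Matrix (Fin n) (Fin n) (Polynomial R) := Polynomial.C.mapMatrix N with hN'
  obtain ⟨Q, hQ⟩ := Polynomial.X_sub_C_dvd_sub_C_eval (a := (Polynomial.X : Polynomial R))
    (p := q.map Polynomial.C)
  have hmap : Polynomial.aeval N' (q.map (Polynomial.C : R →+* Polynomial R)) = 0 := by
    have : Polynomial.aeval N' (q.map (Polynomial.C : R →+* Polynomial R)) =
        (Polynomial.C : R →+* Polynomial R).mapMatrix (Polynomial.aeval N q) := by
      rw [Polynomial.aeval_def, Polynomial.aeval_def, Polynomial.eval₂_map,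
        Polynomial.hom_eval₂]
      congr 1
      ext a i j : 3
      simp [Matrix.algebraMap_matrix_apply, apply_ite]
    rw [this, hq, map_zero]
  have hev : (q.map (Polynomial.C : R →+* Polynomial R)).eval Polynomial.X = q := by
    rw [Polynomial.eval_map, Polynomial.eval₂_C_X]
  have h := congrArg (Polynomial.aeval N') hQ
  rw [map_sub, hmap, hev, map_mul, map_sub, Polynomial.aeval_X, Polynomial.aeval_C,
    Polynomial.aeval_C, zero_sub, ← neg_inj, neg_neg, ← neg_mul, neg_sub] at h
  have hdet := congrArg Matrix.det h
  rw [Matrix.det_mul, Algebra.algebraMap_eq_smul_one, Matrix.det_smul, Matrix.det_one, mul_one,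
    Fintype.card_fin] at hdet
  exact ⟨(Polynomial.aeval N' Q).det, hdet⟩

end Integrality

section Swap

variable {K : Type*} [Field K]

/-- The ring homomorphism `K[T;T⁻¹][t] → K[t][T;T⁻¹]` exchanging the roles of `T` and `t`. -/
noncomputable def swapLaurent : Polynomial K[T;T⁻¹] →+* (Polynomial K)[T;T⁻¹] :=
  Polynomial.eval₂RingHom (AddMonoidAlgebra.mapRingHom ℤ (Polynomial.C : K →+* Polynomial K))
    (LaurentPolynomial.C Polynomial.X)

lemma coeff_swapLaurent (χ : Polynomial K[T;T⁻¹]) (k : ℤ) (i : ℕ) :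
    ((swapLaurent χ).coeff k).coeff i = (χ.coeff i).coeff k := by
  induction χ using Polynomial.induction_on' with
  | add p q hp hq => simp [hp, hq]
  | monomial m a =>
    simp only [swapLaurent, Polynomial.coe_eval₂RingHom, Polynomial.eval₂_monomial]
    rw [← map_pow, mul_comm, ← LaurentPolynomial.smul_eq_C_mul, AddMonoidAlgebra.coeff_smul_apply,
      AddMonoidAlgebra.coeff_mapRingHom, smul_eq_mul, mul_comm, Polynomial.coeff_C_mul_X_pow,
      Polynomial.coeff_monomial]
    by_cases h : i = m
    · simp [h]
    · simp [h, Ne.symm h]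

lemma swapLaurent_eval₂ (j : ℤ) (ψ : Polynomial (Polynomial K)) :
    swapLaurent (ψ.eval₂ (Polynomial.mapRingHom LaurentPolynomial.C)
      (Polynomial.C (LaurentPolynomial.T j))) =
    ψ.eval₂ LaurentPolynomial.C (LaurentPolynomial.T j) := by
  rw [Polynomial.hom_eval₂]
  congr 1
  · ext a : 2
    · simp only [swapLaurent, RingHom.comp_apply, Polynomial.coe_mapRingHom, Polynomial.map_C,
        Polynomial.coe_eval₂RingHom, Polynomial.eval₂_C]
      exact AddMonoidAlgebra.mapRingHom_single _ _ _
    · simp [swapLaurent]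
  · rw [swapLaurent, Polynomial.coe_eval₂RingHom, Polynomial.eval₂_C, LaurentPolynomial.T,
      AddMonoidAlgebra.mapRingHom_single, map_one, LaurentPolynomial.T]

/-- A factor of a polynomial that is monic in `T` has a leading `T`-coefficient that is a unit
of `K[t]`, hence a nonzero constant. -/
lemma exists_top_coeff_of_dvd_toLaurent {z : (Polynomial K)[T;T⁻¹]}
    {ψ : Polynomial (Polynomial K)} (hψ : ψ.Monic) (h : z ∣ Polynomial.toLaurent ψ) :
    ∃ (b : ℤ) (u : K), u ≠ 0 ∧ z.coeff b = Polynomial.C u ∧ ∀ k > b, z.coeff k = 0 := by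
  obtain ⟨g, hg⟩ := h
  obtain ⟨s, P, hP⟩ := z.exists_T_pow
  obtain ⟨s', G, hG⟩ := g.exists_T_pow
  have hmul : P * G = ψ * Polynomial.X ^ (s + s') := by
    apply Polynomial.toLaurent_injective
    rw [map_mul, map_mul, hP, hG, hg, Polynomial.toLaurent_X_pow, Nat.cast_add,
      LaurentPolynomial.T_add]
    ring
  have hlead : IsUnit P.leadingCoeff := by
    have := congrArg Polynomial.leadingCoeff hmul
    rw [Polynomial.leadingCoeff_mul,
      (hψ.mul (Polynomial.monic_X_pow _)).leadingCoeff] at this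
    exact IsUnit.of_mul_eq_one _ this
  obtain ⟨u, hu, hPu⟩ := Polynomial.isUnit_iff.1 hlead
  have hz : z = Polynomial.toLaurent P * LaurentPolynomial.T (-s) := by
    rw [hP, LaurentPolynomial.mul_T_assoc, add_neg_cancel, LaurentPolynomial.T_zero, mul_one]
  have hcoeff : ∀ k : ℤ, z.coeff k = (Polynomial.toLaurent P).coeff (k + s) := by
    intro k
    rw [hz, LaurentPolynomial.T, AddMonoidAlgebra.coeff_mul_single_apply, mul_one, neg_neg]
  refine ⟨P.natDegree - s, u, hu.ne_zero, ?_, fun k hk => ?_⟩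
  · rw [hcoeff, sub_add_cancel, hPu, LaurentPolynomial.coeff_toLaurent]
    exact Finsupp.mapDomain_apply Nat.castEmbedding.injective _ _
  · rw [hcoeff, LaurentPolynomial.coeff_toLaurent]
    obtain ⟨m, hm⟩ := Int.eq_ofNat_of_zero_le (a := k + s) (by omega)
    rw [hm]
    refine (Finsupp.mapDomain_apply Nat.castEmbedding.injective _ _).trans ?_
    exact Polynomial.coeff_eq_zero_of_natDegree_lt (by omega)

end Swap

/-! ### Extreme coefficients of the characteristic polynomial -/

section ExtremeCoefficients

variable {K : Type*} [Field K] {n : ℕ}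

/-- As a Laurent polynomial in `T` over `K[t]`, the polynomial `χ` has a nonzero constant of `K`
as its coefficient of highest degree. -/
def HasConstantTop (χ : Polynomial K[T;T⁻¹]) : Prop :=
  ∃ (b : ℤ) (u : K), u ≠ 0 ∧ (∀ i, (χ.coeff i).coeff b = if i = 0 then u else 0) ∧
    ∀ i, ∀ k > b, (χ.coeff i).coeff k = 0

/-- As a Laurent polynomial in `T` over `K[t]`, the polynomial `χ` has a nonzero constant of `K`
as its coefficient of lowest degree. -/
def HasConstantBottom (χ : Polynomial K[T;T⁻¹]) : Prop :=
  ∃ (a : ℤ) (u : K), u ≠ 0 ∧ (∀ i, (χ.coeff i).coeff a = if i = 0 then u else 0) ∧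
    ∀ i, ∀ k < a, (χ.coeff i).coeff k = 0

lemma hasConstantTop_of_dvd {χ : Polynomial K[T;T⁻¹]} {ψ : Polynomial (Polynomial K)}
    (hψ : ψ.Monic) (h : swapLaurent χ ∣ Polynomial.toLaurent ψ) : HasConstantTop χ := by
  obtain ⟨b, u, hu, hb, hgt⟩ := exists_top_coeff_of_dvd_toLaurent hψ h
  refine ⟨b, u, hu, fun i => ?_, fun i k hk => ?_⟩
  · rw [← coeff_swapLaurent, hb, Polynomial.coeff_C]
  · rw [← coeff_swapLaurent, hgt k hk, Polynomial.coeff_zero]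

lemma hasConstantBottom_of_dvd {χ : Polynomial K[T;T⁻¹]} {ψ : Polynomial (Polynomial K)}
    (hψ : ψ.Monic)
    (h : LaurentPolynomial.invert (swapLaurent χ) ∣ Polynomial.toLaurent ψ) :
    HasConstantBottom χ := by
  obtain ⟨b, u, hu, hb, hgt⟩ := exists_top_coeff_of_dvd_toLaurent hψ h
  rw [LaurentPolynomial.invert_apply] at hb
  refine ⟨-b, u, hu, fun i => ?_, fun i k hk => ?_⟩
  · rw [← coeff_swapLaurent, hb, Polynomial.coeff_C]
  · have := hgt (-k) (by omega)
    rw [LaurentPolynomial.invert_apply, neg_neg] at this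
    rw [← coeff_swapLaurent, this, Polynomial.coeff_zero]

/-- The polynomial ring `K[t]` acts on `K[T;T⁻¹]^n` through `K[t] → K[T;T⁻¹][t]`, with `t` acting
as `N`. -/
lemma finite_of_windowSpan_eq_top {N : Matrix (Fin n) (Fin n) K[T;T⁻¹]} {d : ℕ}
    (h : windowSpan N d = ⊤) :
    @Module.Finite (Polynomial K) (Module.AEval' N.mulVecLin) _ _
      (Module.compHom _ (Polynomial.mapRingHom (LaurentPolynomial.C : K →+* K[T;T⁻¹]))) := by
  let : Module (Polynomial K) (Module.AEval' N.mulVecLin) :=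
    Module.compHom _ (Polynomial.mapRingHom (LaurentPolynomial.C : K →+* K[T;T⁻¹]))
  have hsmul : ∀ (p : Polynomial K) (e : Module.AEval' N.mulVecLin),
    p • e = p.map (LaurentPolynomial.C : K →+* K[T;T⁻¹]) • e := fun _ _ => rfl
  let g : ℤ × Fin n → Module.AEval' N.mulVecLin := fun x =>
    Module.AEval'.of N.mulVecLin (Pi.single x.2 (LaurentPolynomial.T x.1))
  refine ⟨Submodule.fg_def.2 ⟨g '' (Set.Icc (-d : ℤ) d ×ˢ Set.univ),
    ((Set.finite_Icc _ _).prod Set.finite_univ).image _, ?_⟩⟩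
  refine Submodule.eq_top_iff'.2 fun e => ?_
  obtain ⟨v, rfl⟩ := (Module.AEval'.of N.mulVecLin).surjective e
  have hv : v ∈ windowSpan N d := h ▸ Submodule.mem_top
  induction hv using Submodule.span_induction with
  | mem v hv =>
    obtain ⟨l, i, k, hi, rfl⟩ := hv
    have hg : g (i, k) ∈ Submodule.span (Polynomial K)
        (g '' (Set.Icc (-d : ℤ) d ×ˢ Set.univ)) :=
      Submodule.subset_span ⟨(i, k), ⟨⟨by omega, by omega⟩, trivial⟩, rfl⟩
    have hl : Module.AEval'.of N.mulVecLin
        ((N ^ l).mulVec (Pi.single k (LaurentPolynomial.T i))) =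
        (Polynomial.X ^ l : Polynomial K) • g (i, k) := by
      rw [hsmul, Polynomial.map_pow, Polynomial.map_X, Module.AEval'.X_pow_smul_of]
      congr 1
      exact LinearMap.congr_fun (Matrix.toLin'_pow N l) _
    rw [hl]
    exact Submodule.smul_mem _ _ hg
  | zero => rw [map_zero]; exact Submodule.zero_mem _
  | add v w _ _ hv hw => rw [map_add]; exact Submodule.add_mem _ hv hw
  | smul a v _ hv =>
    have : Module.AEval'.of N.mulVecLin (a • v) =
        (Polynomial.C a : Polynomial K) • Module.AEval'.of N.mulVecLin v := by
      rw [hsmul, Polynomial.map_C, Module.AEval.C_smul, ← map_smul]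
      congr 1
      ext1 k
      simp [LaurentPolynomial.smul_eq_C_mul]
    rw [this]
    exact Submodule.smul_mem _ _ hv

/-- Multiplication by `T ^ j` is integral over `K[t]` when `K[T;T⁻¹]^n` is finite over `K[t]`, and
an integral equation for it is a multiple of the characteristic polynomial up to a power. -/
lemma exists_monic_charpoly_dvd {N : Matrix (Fin n) (Fin n) K[T;T⁻¹]} {d : ℕ}
    (h : windowSpan N d = ⊤) (j : ℤ) :
    ∃ ψ : Polynomial (Polynomial K), ψ.Monic ∧
      swapLaurent N.charpoly ∣ ψ.eval₂ LaurentPolynomial.C (LaurentPolynomial.T j) := by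
  obtain ⟨ψ, hψ, hzero⟩ := exists_monic_eval₂_smul_eq_zero _ (finite_of_windowSpan_eq_top h)
    (Polynomial.C (LaurentPolynomial.T j))
  refine ⟨ψ ^ n, hψ.pow n, ?_⟩
  rw [Polynomial.eval₂_pow, ← swapLaurent_eval₂, ← map_pow]
  refine map_dvd swapLaurent (charpoly_dvd_pow_of_aeval_eq_zero N _ ?_)
  apply (Matrix.toLinAlgEquiv' (R := K[T;T⁻¹]) (n := Fin n)).injective
  rw [← Polynomial.aeval_algHom_apply, map_zero]
  refine LinearMap.ext fun v => ?_
  exact (Module.AEval'.of N.mulVecLin).injective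
    ((Module.AEval.of_aeval_smul _ _ v).trans ((hzero _).trans (map_zero _).symm))

lemma toLaurent_eq_eval₂ {R : Type*} [CommRing R] (ψ : Polynomial R) :
    Polynomial.toLaurent ψ = ψ.eval₂ LaurentPolynomial.C (LaurentPolynomial.T 1) := by
  have : Polynomial.toLaurent =
      Polynomial.eval₂RingHom (LaurentPolynomial.C : R →+* R[T;T⁻¹]) (LaurentPolynomial.T 1) := by
    refine Polynomial.ringHom_ext (fun a => ?_) ?_ <;> simp
  rw [this, Polynomial.coe_eval₂RingHom]

lemma hasConstantTop_charpoly {N : Matrix (Fin n) (Fin n) K[T;T⁻¹]} {d : ℕ}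
    (h : windowSpan N d = ⊤) : HasConstantTop N.charpoly := by
  obtain ⟨ψ, hψ, hdvd⟩ := exists_monic_charpoly_dvd h 1
  refine hasConstantTop_of_dvd hψ (hdvd.trans (dvd_of_eq ?_))
  rw [toLaurent_eq_eval₂]

lemma hasConstantBottom_charpoly {N : Matrix (Fin n) (Fin n) K[T;T⁻¹]} {d : ℕ}
    (h : windowSpan N d = ⊤) : HasConstantBottom N.charpoly := by
  obtain ⟨ψ, hψ, hdvd⟩ := exists_monic_charpoly_dvd h (-1)
  refine hasConstantBottom_of_dvd hψ ((map_dvd LaurentPolynomial.invert hdvd).trans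
    (dvd_of_eq ?_))
  rw [toLaurent_eq_eval₂]
  refine (Polynomial.hom_eval₂ _ _ (LaurentPolynomial.invert : _ ≃ₐ[Polynomial K] _).toRingHom
    _).trans ?_
  congr 1
  · exact RingHom.ext fun a => LaurentPolynomial.invert_C a
  · exact LaurentPolynomial.invert_T (-1)

end ExtremeCoefficients

/-! ### Generation by a window -/

section Generation

variable {K : Type*} [Field K] {n : ℕ}

lemma pow_mulVec_mem_windowSpan {N : Matrix (Fin n) (Fin n) K[T;T⁻¹]} {d : ℕ}
    {v : Fin n → K[T;T⁻¹]} (hv : v ∈ windowSpan N d) (m : ℕ) :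
    (N ^ m).mulVec v ∈ windowSpan N d := by
  have hle : windowSpan N d ≤
      (windowSpan N d).comap ((N ^ m).mulVecLin.restrictScalars K) := by
    refine Submodule.span_le.2 ?_
    rintro _ ⟨l, i, k, hi, rfl⟩
    refine Submodule.subset_span ⟨m + l, i, k, hi, ?_⟩
    rw [pow_add, ← Matrix.mulVec_mulVec]
    rfl
  exact hle hv

lemma eq_sum_Icc {α : K[T;T⁻¹]} {a b : ℤ} (h : ∀ q, α.coeff q ≠ 0 → q ∈ Finset.Icc a b) :
    α = ∑ q ∈ Finset.Icc a b, α.coeff q • LaurentPolynomial.T q := by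
  ext k
  rw [AddMonoidAlgebra.coeff_sum, Finsupp.finsetSum_apply]
  simp only [AddMonoidAlgebra.coeff_smul_apply, LaurentPolynomial.T_apply, smul_eq_mul,
    mul_ite, mul_one, mul_zero, Finset.sum_ite_eq']
  split_ifs with hk
  · rfl
  · by_contra hne
    exact hk (h k hne)

/-- The Cayley–Hamilton relation applied to `T ^ j • e_k` and sorted by powers of `T`. -/
lemma sum_coeff_charpoly_smul_eq_zero (N : Matrix (Fin n) (Fin n) K[T;T⁻¹]) {a b : ℤ}
    (h : ∀ i q, (N.charpoly.coeff i).coeff q ≠ 0 → q ∈ Finset.Icc a b) (k : Fin n) (j : ℤ) :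
    ∑ q ∈ Finset.Icc a b, ∑ i ∈ Finset.range (N.charpoly.natDegree + 1),
      (N.charpoly.coeff i).coeff q •
        (N ^ i).mulVec (Pi.single k (LaurentPolynomial.T (j + q))) = 0 := by
  have hCH := congrArg (fun A => A.mulVec (Pi.single k (LaurentPolynomial.T j)))
    N.aeval_self_charpoly
  simp only [Polynomial.aeval_eq_sum_range, Matrix.sum_mulVec, Matrix.zero_mulVec] at hCH
  rw [Finset.sum_comm, ← hCH]
  refine Finset.sum_congr rfl fun i _ => ?_
  have hsingle : N.charpoly.coeff i • (Pi.single k (LaurentPolynomial.T j) : Fin n → K[T;T⁻¹]) =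
      ∑ q ∈ Finset.Icc a b, (N.charpoly.coeff i).coeff q •
        Pi.single k (LaurentPolynomial.T (j + q)) := by
    rw [← Pi.single_smul, smul_eq_mul]
    conv_lhs => rw [eq_sum_Icc (h i)]
    rw [Finset.sum_mul]
    simp only [smul_mul_assoc, ← LaurentPolynomial.T_add, add_comm _ j, ← Pi.single_smul]
    exact map_sum (AddMonoidHom.single (fun _ : Fin n => K[T;T⁻¹]) k) _ _
  rw [Matrix.smul_mulVec, ← Matrix.mulVec_smul, hsingle, Matrix.mulVec_sum]
  simp only [Matrix.mulVec_smul]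

/-- A constant coefficient `u` of `T ^ q₀` in the characteristic polynomial allows solving the
Cayley–Hamilton relation for `T ^ (j + q₀) • e_k`. -/
lemma single_T_mem_windowSpan_of_constant_coeff {N : Matrix (Fin n) (Fin n) K[T;T⁻¹]} {d : ℕ}
    {a b : ℤ} (h : ∀ i q, (N.charpoly.coeff i).coeff q ≠ 0 → q ∈ Finset.Icc a b) {q₀ : ℤ} {u : K}
    (hu : u ≠ 0) (hq₀ : ∀ i, (N.charpoly.coeff i).coeff q₀ = if i = 0 then u else 0)
    {k : Fin n} {j : ℤ} (hmem : ∀ q ∈ Finset.Icc a b, q ≠ q₀ →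
      Pi.single k (LaurentPolynomial.T (j + q)) ∈ windowSpan N d) :
    Pi.single k (LaurentPolynomial.T (j + q₀)) ∈ windowSpan N d := by
  have hrel := sum_coeff_charpoly_smul_eq_zero N h k j
  have hq₀mem : q₀ ∈ Finset.Icc a b := h 0 q₀ (by rw [hq₀, if_pos rfl]; exact hu)
  rw [← Finset.add_sum_erase _ _ hq₀mem, Finset.sum_eq_single 0] at hrel
  · rw [hq₀, if_pos rfl, pow_zero, Matrix.one_mulVec] at hrel
    refine ((windowSpan N d).smul_mem_iff hu).1 ?_
    rw [eq_neg_of_add_eq_zero_left hrel]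
    refine Submodule.neg_mem _ (Submodule.sum_mem _ fun q hq => Submodule.sum_mem _ fun i _ =>
      Submodule.smul_mem _ _ (pow_mulVec_mem_windowSpan ?_ i))
    exact hmem q (Finset.mem_of_mem_erase hq) (Finset.ne_of_mem_erase hq)
  · intro i _ hi
    rw [hq₀, if_neg hi, zero_smul]
  · simp

/-- If both extreme coefficients are constants, Cayley–Hamilton expresses each `T ^ m • e_k`
outside a large window through monomial vectors of smaller absolute degree. -/
lemma exists_windowSpan_eq_top {N : Matrix (Fin n) (Fin n) K[T;T⁻¹]}
    (htop : HasConstantTop N.charpoly) (hbot : HasConstantBottom N.charpoly) :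
    ∃ d, windowSpan N d = ⊤ := by
  obtain ⟨b, u, hu, hb, hgt⟩ := htop
  obtain ⟨a, w, hw, ha, hlt⟩ := hbot
  have hIcc : ∀ i q, (N.charpoly.coeff i).coeff q ≠ 0 → q ∈ Finset.Icc a b := by
    intro i q hq
    rw [Finset.mem_Icc]
    constructor
    · by_contra! hlt'
      exact hq (hlt i q hlt')
    · by_contra! hgt'
      exact hq (hgt i q hgt')
  set d := max a.natAbs b.natAbs with hd
  have hmem : ∀ (s : ℕ) (m : ℤ) (k : Fin n), m.natAbs ≤ s →
      Pi.single k (LaurentPolynomial.T m) ∈ windowSpan N d := by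
    intro s
    induction s with
    | zero =>
      intro m k hm
      exact Submodule.subset_span ⟨0, m, k, by omega, by rw [pow_zero, Matrix.one_mulVec]⟩
    | succ s ih =>
      intro m k hm
      by_cases hmd : m.natAbs ≤ d
      · exact Submodule.subset_span ⟨0, m, k, hmd, by rw [pow_zero, Matrix.one_mulVec]⟩
      -- The top coefficient reaches `m > d` from below, the bottom one `m < -d` from above;
      -- `|a|, |b| ≤ d` keeps the other exponents of the relation within `[-s, s]`.
      rcases le_total 0 m with hm0 | hm0
      · have := single_T_mem_windowSpan_of_constant_coeff (d := d) (k := k) (j := m - b)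
          hIcc hu hb fun q hq hne => ih _ _ (by rw [Finset.mem_Icc] at hq; omega)
        rwa [sub_add_cancel] at this
      · have := single_T_mem_windowSpan_of_constant_coeff (d := d) (k := k) (j := m - a)
          hIcc hw ha fun q hq hne => ih _ _ (by rw [Finset.mem_Icc] at hq; omega)
        rwa [sub_add_cancel] at this
  refine ⟨d, ?_⟩
  have hid : (windowSpan N d).mkQ = 0 := linearMap_ext_single fun k i => by
    rw [LinearMap.zero_apply, Submodule.mkQ_apply, Submodule.Quotient.mk_eq_zero]
    exact hmem _ i k le_rfl
  rw [← Submodule.ker_mkQ (windowSpan N d), hid, LinearMap.ker_zero]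

end Generation

/-! ### Expansive polynomials -/

section Degrees

variable {K : Type*} [Field K]

lemma posDeg_lt_coe_iff {α : K[T;T⁻¹]} {b : ℤ} :
    posDeg α < b ↔ ∀ k ≥ b, α.coeff k = 0 := by
  rw [posDeg, LaurentPolynomial.degree, Finset.max, Finset.sup_lt_iff (WithBot.bot_lt_coe b)]
  simp only [Finsupp.mem_support_iff, WithBot.coe_lt_coe]
  exact forall_congr' fun k => by rw [← not_le, not_imp_not]

lemma coe_lt_negDeg_iff {α : K[T;T⁻¹]} {a : ℤ} :
    (a : WithTop ℤ) < negDeg α ↔ ∀ k ≤ a, α.coeff k = 0 := by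
  rw [negDeg, Finset.min, Finset.lt_inf_iff (WithTop.coe_lt_top a)]
  simp only [Finsupp.mem_support_iff, WithTop.coe_lt_coe]
  exact forall_congr' fun k => by rw [← not_le, not_imp_not]

lemma posDeg_eq_coe_iff {α : K[T;T⁻¹]} {b : ℤ} :
    posDeg α = b ↔ α.coeff b ≠ 0 ∧ ∀ k > b, α.coeff k = 0 := by
  constructor
  · intro h
    refine ⟨Finsupp.mem_support_iff.1 (Finset.mem_of_max h), fun k hk => ?_⟩
    refine posDeg_lt_coe_iff.1 (h.trans_lt (WithBot.coe_lt_coe.2 hk)) k le_rfl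
  · rintro ⟨h, hgt⟩
    refine le_antisymm (not_lt.1 fun hlt => ?_) (Finset.le_max (Finsupp.mem_support_iff.2 h))
    obtain ⟨c, hc⟩ := WithBot.ne_bot_iff_exists.1 (ne_bot_of_gt hlt)
    rw [← hc, WithBot.coe_lt_coe] at hlt
    exact Finsupp.mem_support_iff.1 (Finset.mem_of_max hc.symm) (hgt c hlt)

lemma negDeg_eq_coe_iff {α : K[T;T⁻¹]} {a : ℤ} :
    negDeg α = a ↔ α.coeff a ≠ 0 ∧ ∀ k < a, α.coeff k = 0 := by
  constructor
  · intro h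
    refine ⟨Finsupp.mem_support_iff.1 (Finset.mem_of_min h), fun k hk => ?_⟩
    refine coe_lt_negDeg_iff.1 ((WithTop.coe_lt_coe.2 hk).trans_eq h.symm) k le_rfl
  · rintro ⟨h, hlt⟩
    refine le_antisymm (Finset.min_le (Finsupp.mem_support_iff.2 h)) (not_lt.1 fun hgt => ?_)
    obtain ⟨c, hc⟩ := WithTop.ne_top_iff_exists.1 (ne_top_of_lt hgt)
    rw [← hc, WithTop.coe_lt_coe] at hgt
    exact Finsupp.mem_support_iff.1 (Finset.mem_of_min hc.symm) (hlt c hgt)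

/-- The sign condition on `posDeg (χ.coeff 0)` says that it exceeds the degree `0` of the leading
coefficient `1` of `χ`, which `ExpansivePolynomial` does not list among the others. -/
lemma hasConstantTop_iff {χ : Polynomial K[T;T⁻¹]} (hχ : χ.Monic) (hdeg : 0 < χ.natDegree) :
    HasConstantTop χ ↔ χ.coeff 0 ≠ 0 ∧ 0 < posDeg (χ.coeff 0) ∧
      ∀ i : ℕ, 1 ≤ i → i < χ.natDegree → posDeg (χ.coeff i) < posDeg (χ.coeff 0) := by
  have hone : posDeg (χ.coeff χ.natDegree) = ((0 : ℤ) : WithBot ℤ) := by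
    rw [hχ.coeff_natDegree, posDeg_eq_coe_iff]
    refine ⟨by simp, fun k hk => ?_⟩
    rw [← LaurentPolynomial.T_zero, LaurentPolynomial.T_apply, if_neg hk.ne]
  constructor
  · rintro ⟨b, u, hu, hb, hgt⟩
    have h0 : posDeg (χ.coeff 0) = b :=
      posDeg_eq_coe_iff.2 ⟨by rw [hb, if_pos rfl]; exact hu, hgt 0⟩
    have hi : ∀ i, 1 ≤ i → posDeg (χ.coeff i) < b := fun i hi => posDeg_lt_coe_iff.2 fun k hk => by
      rcases hk.eq_or_lt with rfl | hk
      · rw [hb, if_neg (by omega)]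
      · exact hgt i k hk
    refine ⟨fun hz => ?_, ?_, fun i h1 _ => h0 ▸ hi i h1⟩
    · have := hb 0
      rw [hz, if_pos rfl] at this
      exact hu this.symm
    · rw [h0]
      have := hi _ hdeg
      rwa [hone] at this
  · rintro ⟨hne, hpos, hlt⟩
    obtain ⟨b, hb⟩ := WithBot.ne_bot_iff_exists.1 (ne_bot_of_gt hpos)
    have hi : ∀ i, 1 ≤ i → posDeg (χ.coeff i) < b := by
      intro i hi
      rw [hb]
      rcases lt_trichotomy i χ.natDegree with h | rfl | h
      · exact hlt i hi h
      · rw [hone]; exact hpos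
      · rw [Polynomial.coeff_eq_zero_of_natDegree_lt h]
        exact bot_lt_of_lt hpos
    obtain ⟨h0, hgt⟩ := posDeg_eq_coe_iff.1 hb.symm
    refine ⟨b, _, h0, fun i => ?_, fun i k hk => ?_⟩
    · split_ifs with h
      · rw [h]
      · exact posDeg_lt_coe_iff.1 (hi i (by omega)) b le_rfl
    · rcases Nat.eq_zero_or_pos i with rfl | h
      · exact hgt k hk
      · exact posDeg_lt_coe_iff.1 (hi i h) k hk.le

lemma hasConstantBottom_iff {χ : Polynomial K[T;T⁻¹]} (hχ : χ.Monic) (hdeg : 0 < χ.natDegree) :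
    HasConstantBottom χ ↔ χ.coeff 0 ≠ 0 ∧ negDeg (χ.coeff 0) < 0 ∧
      ∀ i : ℕ, 1 ≤ i → i < χ.natDegree → negDeg (χ.coeff 0) < negDeg (χ.coeff i) := by
  have hone : negDeg (χ.coeff χ.natDegree) = ((0 : ℤ) : WithTop ℤ) := by
    rw [hχ.coeff_natDegree, negDeg_eq_coe_iff]
    refine ⟨by simp, fun k hk => ?_⟩
    rw [← LaurentPolynomial.T_zero, LaurentPolynomial.T_apply, if_neg hk.ne']
  constructor
  · rintro ⟨a, u, hu, ha, hlt⟩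
    have h0 : negDeg (χ.coeff 0) = a :=
      negDeg_eq_coe_iff.2 ⟨by rw [ha, if_pos rfl]; exact hu, hlt 0⟩
    have hi : ∀ i, 1 ≤ i → a < negDeg (χ.coeff i) := fun i hi => coe_lt_negDeg_iff.2 fun k hk => by
      rcases hk.eq_or_lt with rfl | hk
      · rw [ha, if_neg (by omega)]
      · exact hlt i k hk
    refine ⟨fun hz => ?_, ?_, fun i h1 _ => h0 ▸ hi i h1⟩
    · have := ha 0
      rw [hz, if_pos rfl] at this
      exact hu this.symm
    · rw [h0]
      have := hi _ hdeg
      rwa [hone] at this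
  · rintro ⟨hne, hneg, hgt⟩
    obtain ⟨a, ha⟩ := WithTop.ne_top_iff_exists.1 (ne_top_of_lt hneg)
    have hi : ∀ i, 1 ≤ i → a < negDeg (χ.coeff i) := by
      intro i hi
      rw [ha]
      rcases lt_trichotomy i χ.natDegree with h | rfl | h
      · exact hgt i hi h
      · rw [hone]; exact hneg
      · rw [Polynomial.coeff_eq_zero_of_natDegree_lt h]
        exact lt_top_of_lt hneg
    obtain ⟨h0, hlt⟩ := negDeg_eq_coe_iff.1 ha.symm
    refine ⟨a, _, h0, fun i => ?_, fun i k hk => ?_⟩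
    · split_ifs with h
      · rw [h]
      · exact coe_lt_negDeg_iff.1 (hi i (by omega)) a le_rfl
    · rcases Nat.eq_zero_or_pos i with rfl | h
      · exact hlt k hk
      · exact coe_lt_negDeg_iff.1 (hi i h) k hk.le

end Degrees

theorem theorem1 (p n : ℕ) (hp : p.Prime) (hn : 1 < n)
    (F : Config (Fin n → ZMod p) → Config (Fin n → ZMod p))
    (M : Matrix (Fin n) (Fin n) (LaurentPolynomial (ZMod p)))
    (hF : IsLinearCAWithMatrix F M) :
    PositivelyExpansive F ↔ ExpansiveMatrix M := by
  have : Fact p.Prime := ⟨hp⟩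
  obtain ⟨r, A, rfl, rfl⟩ := hF
  rw [positivelyExpansive_iff_windowSpan, ExpansiveMatrix, ExpansivePolynomial]
  set χ := (laurentMatrix r A).charpoly with hχ
  have hmonic : χ.Monic := Matrix.charpoly_monic _
  have hdeg : 0 < χ.natDegree := by
    rw [hχ, Matrix.charpoly_natDegree_eq_dim, Fintype.card_fin]
    omega
  have hiff : (∃ d, windowSpan (laurentMatrix r A).transpose d = ⊤) ↔
      HasConstantTop χ ∧ HasConstantBottom χ := by
    rw [hχ, ← Matrix.charpoly_transpose]
    exact ⟨fun ⟨_, h⟩ => ⟨hasConstantTop_charpoly h, hasConstantBottom_charpoly h⟩,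
      fun h => exists_windowSpan_eq_top h.1 h.2⟩
  rw [hiff, hasConstantTop_iff hmonic hdeg, hasConstantBottom_iff hmonic hdeg]
  tauto
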